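/- Let $\mathcal V^2(T^2)$ be the space of $C^2$ vector fields on the two-torus $T^2=\mathbb R^2/\mathbb Z^2$, with the $C^2$ topology. Call $v,w\in\mathcal V^2(T^2)$ orbitally topologically equivalent, $v\sim w$, if there is a homeomorphism $H\colon T^2\to T^2$, homotopic to the identity, that takes orbits of $v$ to orbits of $w$, preserving time orientation. Then orbital topological equivalence on $\mathcal V^2(T^2)$ is not smooth (has no complete Borel numerical invariant): there is no Borel function $g\colon \mathcal V^2(T^2)\to Y$ with $Y$ a Polish space such that for all $v,w\in\mathcal V^2(T^2)$ we have $v\sim w$ if and only if $g(v)=g(w)$. -/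

import Mathlib

/-- The two-torus `T² = (ℝ/ℤ)² = ℝ²/ℤ²`. -/
abbrev Torus : Type := UnitAddCircle × UnitAddCircle

/-- The covering projection `ℝ² → T²`. -/
def Torus.proj (p : ℝ × ℝ) : Torus := ((p.1 : UnitAddCircle), (p.2 : UnitAddCircle))

/-- A `C²` vector field on the torus. The tangent bundle of `T² = ℝ²/ℤ²` is trivialized by the
coordinate vector fields, so a vector field is a function `T² → ℝ²`; it is of class `C²` when its
lift to `ℝ²` is (the projection is a local diffeomorphism). -/
structure C2VectorField : Type where
  /-- the components of the vector field in the coordinate frame -/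
  toFun : Torus → ℝ × ℝ
  contDiff_lift : ContDiff ℝ 2 (fun p : ℝ × ℝ => toFun (Torus.proj p))

namespace C2VectorField

/-- The lift of a vector field on the torus to a (`ℤ²`-periodic) vector field on `ℝ²`. -/
def lift (v : C2VectorField) : ℝ × ℝ → ℝ × ℝ := fun p => v.toFun (Torus.proj p)

theorem contDiff_fderiv_lift (v : C2VectorField) : ContDiff ℝ 1 (fderiv ℝ v.lift) :=
  ContDiff.fderiv_right (m := 1) v.contDiff_lift (by norm_num)

/-- The vector field, its first derivative and its second derivative, as continuous maps. -/
noncomputable def jet (v : C2VectorField) :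
    C(ℝ × ℝ, ℝ × ℝ) × C(ℝ × ℝ, (ℝ × ℝ) →L[ℝ] (ℝ × ℝ)) ×
      C(ℝ × ℝ, (ℝ × ℝ) →L[ℝ] (ℝ × ℝ) →L[ℝ] (ℝ × ℝ)) :=
  (⟨v.lift, v.contDiff_lift.continuous⟩,
    ⟨fderiv ℝ v.lift, v.contDiff_fderiv_lift.continuous⟩,
    ⟨fderiv ℝ (fderiv ℝ v.lift), v.contDiff_fderiv_lift.continuous_fderiv one_ne_zero⟩)

/-- The `C²` topology: convergence of a vector field together with its derivatives of order at
most two. The spaces of continuous maps carry the compact-open topology; as all the maps in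
question are `ℤ²`-periodic, locally uniform convergence is uniform convergence, and this is the
topology of the `C²` norm. -/
noncomputable instance : TopologicalSpace C2VectorField := TopologicalSpace.induced jet inferInstance

/-- The σ-algebra of Borel sets of the `C²` topology. -/
noncomputable instance : MeasurableSpace C2VectorField := borel C2VectorField

instance : BorelSpace C2VectorField := ⟨rfl⟩

/-- `γ : ℝ → T²` is a trajectory of `v`: it is the projection of an integral curve of the lifted
vector field. As the torus is compact, every point lies on a trajectory that is defined for all
times. The orbits of `v` are the images of its trajectories. -/
def IsTrajectory (v : C2VectorField) (γ : ℝ → Torus) : Prop :=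
  ∃ c : ℝ → ℝ × ℝ, (∀ t, HasDerivAt c (v.lift (c t)) t) ∧ ∀ t, γ t = Torus.proj (c t)

/-- Orbital topological equivalence: there is a homeomorphism `H` of the torus, homotopic to the
identity, that takes every orbit of `v` onto an orbit of `w` and preserves the orientation of the
orbits by time, i.e. takes each trajectory of `v` to a trajectory of `w` up to an increasing
bijective change `τ : ℝ → ℝ` of the time. -/
def OrbitallyEquivalent (v w : C2VectorField) : Prop :=
  ∃ H : Torus ≃ₜ Torus,
    ContinuousMap.Homotopic (H : C(Torus, Torus)) (ContinuousMap.id Torus) ∧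
    ∀ γ : ℝ → Torus, v.IsTrajectory γ →
      ∃ (τ : ℝ ≃o ℝ) (δ : ℝ → Torus), w.IsTrajectory δ ∧ ∀ t, H (γ t) = δ (τ t)

end C2VectorField

/-!
# Orbital equivalence of vector fields on the torus has no complete Borel invariant

Fix an irrational slope `α` and, for a point `q` of the torus, consider the vector field
`twoZeroField α q = f_q • (1, α)`, where `f_q ≥ 0` vanishes exactly at `0` and `q`, to second order.
Its orbits are the two zeros and the pieces into which they cut the leaves of the linear flow of
slope `α`. Restricted to `q = (0, x)`, orbital equivalence is essentially the orbit equivalence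
relation of the rotation `x ↦ x + α` of the circle, whose ergodicity excludes a complete Borel
invariant.

*Equivalent fields.* Moving every point `z` along its leaf by a small time proportional to `hump z`,
a function that vanishes only at the origin, is a homeomorphism homotopic to the identity that fixes
`0` and moves `q` along its leaf. It takes the orbits of `twoZeroField α q` to those of the field with
the displaced zero; as both fields vanish to second order at corresponding points, the required time
change has speed bounded below, so it is onto `ℝ` (`orbitallyEquivalent_twoZeroField_slide`). Hence the
class is locally constant as `q` moves along a leaf that avoids `0`, and following the leaf once
around the torus gives the equivalence of the parameters `x` and `x + α`
(`invariant_twoZeroField_add`).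

*Inequivalent fields.* A homeomorphism `H` homotopic to the identity is `z ↦ z + d z` with a
displacement `d` that lifts to a continuous map `T² → ℝ²`. If `H` takes orbits to orbits, the component
of `d` transverse to the leaves is constant along each orbit, hence constant, as some orbit is a
complete leaf and therefore dense. Since `H` matches the zeros, an equivalence between the parameters
`x ≠ 0` and `x'` forces `x' - x` or `x' + x` to be a multiple of `α` modulo `1`
(`sub_mem_or_add_mem_of_orbitallyEquivalent`), so classes of parameters are countable.

A complete Borel invariant, as a function of `x`, would be invariant under the rotation outside a
countable set, hence almost everywhere constant, so that almost all parameters would lie in one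
countable class.
-/

open Real Set Filter Topology

/-! ### Time changes on the line -/

/-- A continuous speed `ρ` that is bounded below by a positive constant is the derivative of an
order isomorphism of the line. -/
theorem exists_orderIso_hasDerivAt {ρ : ℝ → ℝ} (hρ : Continuous ρ) {m : ℝ} (hm : 0 < m)
    (hmρ : ∀ t, m ≤ ρ t) :
    ∃ τ : ℝ ≃o ℝ, (∀ t, HasDerivAt τ (ρ t) t) ∧
      ∀ s, HasDerivAt τ.symm (ρ (τ.symm s))⁻¹ s := by
  set f : ℝ → ℝ := fun t => ∫ x in (0 : ℝ)..t, ρ x with hf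
  have hd : ∀ t, HasDerivAt f (ρ t) t := fun t =>
    intervalIntegral.integral_hasDerivAt_right (hρ.intervalIntegrable _ _)
      (hρ.stronglyMeasurableAtFilter _ _) hρ.continuousAt
  have hdiff : Differentiable ℝ f := fun t => (hd t).differentiableAt
  have hgrow : ∀ s t, s ≤ t → m * (t - s) ≤ f t - f s := fun s t hst =>
    mul_sub_le_image_sub_of_le_deriv hdiff (fun x => by rw [(hd x).deriv]; exact hmρ x) hst
  have hmono : StrictMono f := fun s t hst => by
    have := hgrow s t hst.le
    have := mul_pos hm (sub_pos.2 hst)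
    linarith
  have h0 : f 0 = 0 := by simp [hf]
  have hsurj : Function.Surjective f := by
    refine hdiff.continuous.surjective ?_ ?_
    · refine tendsto_atTop_mono' _ ?_ (tendsto_id.const_mul_atTop hm)
      filter_upwards [eventually_ge_atTop 0] with t ht
      have := hgrow 0 t ht
      simp only [id]; linarith
    · refine tendsto_atBot_mono' _ ?_ (tendsto_id.const_mul_atBot hm)
      filter_upwards [eventually_le_atBot 0] with t ht
      have := hgrow t 0 ht
      simp only [id]; linarith
  set τ : ℝ ≃o ℝ := StrictMono.orderIsoOfSurjective f hmono hsurj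
  have hτ : ⇑τ = f := rfl
  refine ⟨τ, fun t => hτ ▸ hd t, fun s => ?_⟩
  refine HasDerivAt.of_local_left_inverse (f := τ) τ.symm.continuous.continuousAt (hτ ▸ hd _)
    (hm.trans_le (hmρ _)).ne' (Eventually.of_forall fun y => τ.apply_symm_apply y)

/-- A solution of a scalar linear differential equation with continuous coefficient vanishes
identically as soon as it vanishes once. -/
theorem eq_zero_of_hasDerivAt_mul_self {r m : ℝ → ℝ} (hm : Continuous m)
    (hr : ∀ t, HasDerivAt r (r t * m t) t) {t₀ : ℝ} (h₀ : r t₀ = 0) (t : ℝ) : r t = 0 := by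
  set E : ℝ → ℝ := fun t => r t * exp (-∫ x in (0 : ℝ)..t, m x) with hE
  have hd : ∀ t, HasDerivAt E 0 t := fun t => by
    have h1 : HasDerivAt (fun t => ∫ x in (0 : ℝ)..t, m x) (m t) t :=
      intervalIntegral.integral_hasDerivAt_right (hm.intervalIntegrable _ _)
        (hm.stronglyMeasurableAtFilter _ _) hm.continuousAt
    convert! (hr t).mul h1.neg.exp using 1
    ring
  have hc : E t = E t₀ :=
    is_const_of_deriv_eq_zero (fun t => (hd t).differentiableAt) (fun t => (hd t).deriv) t t₀
  simpa [hE, h₀, (exp_pos _).ne'] using hc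

/-! ### A function on the torus vanishing quadratically at the origin -/

/-- The function `t ↦ sin² (π t)` on the circle `ℝ/ℤ`; it is comparable to the squared distance
to `0`. -/
noncomputable def sinSq : UnitAddCircle → ℝ :=
  Function.Periodic.lift (f := fun t : ℝ => sin (π * t) ^ 2) (c := 1) fun t => by
    simp [mul_add, sin_add_pi]

theorem sinSq_coe (t : ℝ) : sinSq (t : UnitAddCircle) = sin (π * t) ^ 2 := rfl

theorem sinSq_nonneg (x : UnitAddCircle) : 0 ≤ sinSq x := by
  induction x using QuotientAddGroup.induction_on with | _ t => exact sq_nonneg _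

theorem sinSq_le_one (x : UnitAddCircle) : sinSq x ≤ 1 := by
  induction x using QuotientAddGroup.induction_on with | _ t => exact sin_sq_le_one _

theorem continuous_sinSq : Continuous sinSq :=
  continuous_coinduced_dom.2 (by
    change Continuous fun t : ℝ => sin (π * t) ^ 2
    fun_prop)

theorem UnitAddCircle.coe_eq_zero_iff {t : ℝ} : (t : UnitAddCircle) = 0 ↔ ∃ n : ℤ, t = n := by
  rw [AddCircle.coe_eq_zero_iff]
  simp [eq_comm]

theorem sinSq_eq_zero_iff {x : UnitAddCircle} : sinSq x = 0 ↔ x = 0 := by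
  induction x using QuotientAddGroup.induction_on with | _ t => ?_
  change sin (π * t) ^ 2 = 0 ↔ (t : UnitAddCircle) = 0
  rw [UnitAddCircle.coe_eq_zero_iff, sq_eq_zero_iff, sin_eq_zero_iff]
  refine exists_congr fun n => ?_
  rw [mul_comm π t, mul_left_inj' pi_ne_zero, eq_comm]

theorem sinSq_add_coe_le (x : UnitAddCircle) (b : ℝ) :
    sinSq (x + (b : UnitAddCircle)) ≤ 2 * sinSq x + 2 * (π * b) ^ 2 := by
  induction x using QuotientAddGroup.induction_on with | _ t => ?_
  change sin (π * (t + b)) ^ 2 ≤ 2 * sin (π * t) ^ 2 + 2 * (π * b) ^ 2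
  have h1 : sin (π * b) ^ 2 ≤ (π * b) ^ 2 := sq_le_sq.2 (abs_sin_le_abs)
  have h2 := sin_sq_add_cos_sq (π * t)
  have h3 := sin_sq_add_cos_sq (π * b)
  rw [mul_add, sin_add]
  nlinarith [sq_nonneg (sin (π * t) * cos (π * b) - cos (π * t) * sin (π * b)),
    mul_nonneg (sq_nonneg (sin (π * t))) (sq_nonneg (sin (π * b)))]

theorem sin_sq_sub_sin_sq (a b : ℝ) : sin a ^ 2 - sin b ^ 2 = sin (a - b) * sin (a + b) := by
  rw [sin_sub, sin_add]
  nlinarith [sin_sq_add_cos_sq a, sin_sq_add_cos_sq b]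

theorem sq_sinSq_sub_le (x y : UnitAddCircle) : (sinSq x - sinSq y) ^ 2 ≤ sinSq (x - y) := by
  induction x using QuotientAddGroup.induction_on with | _ s => ?_
  induction y using QuotientAddGroup.induction_on with | _ t => ?_
  change (sin (π * s) ^ 2 - sin (π * t) ^ 2) ^ 2 ≤ sin (π * (s - t)) ^ 2
  rw [sin_sq_sub_sin_sq, mul_pow, mul_sub]
  exact mul_le_of_le_one_right (sq_nonneg _) (sin_sq_le_one _)

theorem abs_sinSq_add_coe_sub_le (x : UnitAddCircle) (b : ℝ) :
    |sinSq (x + (b : UnitAddCircle)) - sinSq x| ≤ π * |b| := by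
  induction x using QuotientAddGroup.induction_on with | _ t => ?_
  change |sin (π * (t + b)) ^ 2 - sin (π * t) ^ 2| ≤ _
  rw [sin_sq_sub_sin_sq, abs_mul, ← mul_sub, add_sub_cancel_left]
  refine (mul_le_of_le_one_right (abs_nonneg _) (abs_sin_le_one _)).trans ?_
  refine abs_sin_le_abs.trans ?_
  rw [abs_mul, abs_of_pos pi_pos]

theorem HasDerivAt.sinSq_coe {u : ℝ → ℝ} {u' t : ℝ} (hu : HasDerivAt u u' t) :
    HasDerivAt (fun t => sinSq (u t : UnitAddCircle)) (u' * (π * Real.sin (2 * (π * u t)))) t := by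
  simp only [_root_.sinSq_coe]
  convert! ((HasDerivAt.sin (hu.const_mul π)).pow 2) using 1
  rw [sin_two_mul]
  push_cast
  ring

/-- The function `(x, y) ↦ sin² (π x) + sin² (π y)` on the torus; it is comparable to the squared
distance to the origin, its only zero. -/
noncomputable def hump (z : Torus) : ℝ := sinSq z.1 + sinSq z.2

theorem hump_proj (p : ℝ × ℝ) : hump (Torus.proj p) = sin (π * p.1) ^ 2 + sin (π * p.2) ^ 2 := rfl

theorem hump_nonneg (z : Torus) : 0 ≤ hump z := add_nonneg (sinSq_nonneg _) (sinSq_nonneg _)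

theorem hump_le_two (z : Torus) : hump z ≤ 2 := by
  have := sinSq_le_one z.1
  have := sinSq_le_one z.2
  unfold hump
  linarith

theorem hump_eq_zero_iff {z : Torus} : hump z = 0 ↔ z = 0 := by
  rw [hump, add_eq_zero_iff_of_nonneg (sinSq_nonneg _) (sinSq_nonneg _), sinSq_eq_zero_iff,
    sinSq_eq_zero_iff, Prod.ext_iff]
  rfl

theorem hump_pos {z : Torus} (hz : z ≠ 0) : 0 < hump z :=
  (hump_nonneg z).lt_of_ne' (hump_eq_zero_iff.not.2 hz)

@[fun_prop]
theorem continuous_hump : Continuous hump :=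
  (continuous_sinSq.comp continuous_fst).add (continuous_sinSq.comp continuous_snd)

theorem sq_hump_sub_le (z w : Torus) : (hump z - hump w) ^ 2 ≤ 2 * hump (z - w) := by
  have h1 := sq_sinSq_sub_le z.1 w.1
  have h2 := sq_sinSq_sub_le z.2 w.2
  simp only [hump, Prod.fst_sub, Prod.snd_sub]
  nlinarith [sq_nonneg ((sinSq z.1 - sinSq w.1) - (sinSq z.2 - sinSq w.2))]

/-! ### The linear flow of slope `α` -/

namespace Torus

/-- The time-`t` map `z ↦ z + t • (1, α)` of the linear flow of slope `α` on the torus. -/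
def flow (α t : ℝ) (z : Torus) : Torus := z + proj (t, α * t)

theorem proj_add (p q : ℝ × ℝ) : proj (p + q) = proj p + proj q := by
  simp [proj]

theorem proj_sub (p q : ℝ × ℝ) : proj (p - q) = proj p - proj q := by
  simp [proj]

theorem proj_surjective : Function.Surjective proj := by
  rintro ⟨x, y⟩
  obtain ⟨s, rfl⟩ := QuotientAddGroup.mk_surjective x
  obtain ⟨t, rfl⟩ := QuotientAddGroup.mk_surjective y
  exact ⟨(s, t), rfl⟩

@[fun_prop]
theorem continuous_proj : Continuous proj := by
  unfold proj
  exact ((AddCircle.continuous_mk' 1).comp continuous_fst).prodMk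
    ((AddCircle.continuous_mk' 1).comp continuous_snd)

theorem flow_zero (α : ℝ) (z : Torus) : flow α 0 z = z := by simp [flow, proj]

theorem flow_add (α s t : ℝ) (z : Torus) : flow α (s + t) z = flow α s (flow α t z) := by
  simp only [flow, add_assoc, ← proj_add, Prod.mk_add_mk, mul_add]
  rw [add_comm s, add_comm (α * s)]

theorem flow_proj (α t : ℝ) (p : ℝ × ℝ) : flow α t (proj p) = proj (p + t • ((1, α) : ℝ × ℝ)) := by
  simp [flow, proj_add, mul_comm]

@[fun_prop]
theorem continuous_flow (α : ℝ) : Continuous fun p : ℝ × Torus => flow α p.1 p.2 := by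
  unfold flow
  fun_prop

end Torus

open Torus

theorem hump_flow_le (α b : ℝ) (z : Torus) :
    hump (flow α b z) ≤ 2 * hump z + 2 * π ^ 2 * (1 + α ^ 2) * b ^ 2 := by
  have h1 := sinSq_add_coe_le z.1 b
  have h2 := sinSq_add_coe_le z.2 (α * b)
  simp only [hump, flow, proj, Prod.fst_add, Prod.snd_add]
  linear_combination h1 + h2

theorem abs_hump_flow_sub_le (α b : ℝ) (z : Torus) :
    |hump (flow α b z) - hump z| ≤ π * (1 + |α|) * |b| := by
  have h1 := abs_sinSq_add_coe_sub_le z.1 b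
  have h2 := abs_sinSq_add_coe_sub_le z.2 (α * b)
  rw [abs_mul] at h2
  simp only [hump, flow, proj, Prod.fst_add, Prod.snd_add]
  rw [add_sub_add_comm]
  refine (abs_add_le _ _).trans ?_
  linear_combination h1 + h2

/-- The derivative of (the lift of) `hump` in the direction `(1, α)`. -/
noncomputable def humpDeriv (α : ℝ) (p : ℝ × ℝ) : ℝ :=
  π * sin (2 * (π * p.1)) + α * (π * sin (2 * (π * p.2)))

@[fun_prop]
theorem continuous_humpDeriv (α : ℝ) : Continuous (humpDeriv α) := by
  unfold humpDeriv
  fun_prop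

theorem abs_humpDeriv_le (α : ℝ) (p : ℝ × ℝ) : |humpDeriv α p| ≤ π * (1 + |α|) := by
  refine (abs_add_le _ _).trans ?_
  rw [abs_mul, abs_mul, abs_mul, abs_of_pos pi_pos]
  have h1 := abs_sin_le_one (2 * (π * p.1))
  have h2 := abs_sin_le_one (2 * (π * p.2))
  have h3 := mul_le_mul_of_nonneg_left h1 pi_pos.le
  have h4 := mul_le_mul_of_nonneg_left h2 (mul_nonneg (abs_nonneg α) pi_pos.le)
  linear_combination h3 + h4

theorem HasDerivAt.hump_proj {α : ℝ} {c : ℝ → ℝ × ℝ} {r t : ℝ}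
    (hc : HasDerivAt c (r • ((1, α) : ℝ × ℝ)) t) :
    HasDerivAt (fun t => hump (proj (c t))) (r * humpDeriv α (c t)) t := by
  have h1 : HasDerivAt (fun t => (c t).1) r t := by
    convert! (ContinuousLinearMap.fst ℝ ℝ ℝ).hasFDerivAt.comp_hasDerivAt t hc using 1
    simp
  have h2 : HasDerivAt (fun t => (c t).2) (r * α) t := by
    convert! (ContinuousLinearMap.snd ℝ ℝ ℝ).hasFDerivAt.comp_hasDerivAt t hc using 1
  convert! (HasDerivAt.sinSq_coe h1).add (HasDerivAt.sinSq_coe h2) using 1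
  unfold humpDeriv
  ring

/-! ### Vector fields of constant direction with two zeros -/

theorem contDiff_hump_proj {n : WithTop ℕ∞} : ContDiff ℝ n fun p : ℝ × ℝ => hump (proj p) := by
  simp only [hump_proj]
  fun_prop

theorem contDiff_twoZeroField_lift (α : ℝ) {n : WithTop ℕ∞} :
    ContDiff ℝ n fun x : (ℝ × ℝ) × (ℝ × ℝ) =>
      (hump (proj x.2) * hump (proj x.2 - proj x.1)) • ((1, α) : ℝ × ℝ) := by
  simp only [← proj_sub, hump_proj]
  fun_prop

/-- The vector field on the torus of constant direction `(1, α)` whose zeros are `0` and `q`. -/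
noncomputable def twoZeroField (α : ℝ) (q : Torus) : C2VectorField where
  toFun z := (hump z * hump (z - q)) • ((1, α) : ℝ × ℝ)
  contDiff_lift := by
    obtain ⟨q, rfl⟩ := proj_surjective q
    simp only [← proj_sub, hump_proj]
    fun_prop

theorem lift_twoZeroField (α : ℝ) (q : Torus) (p : ℝ × ℝ) :
    (twoZeroField α q).lift p = (hump (proj p) * hump (proj p - q)) • ((1, α) : ℝ × ℝ) := rfl

theorem lift_twoZeroField_eq_zero_iff {α : ℝ} {q : Torus} {p : ℝ × ℝ} :
    (twoZeroField α q).lift p = 0 ↔ proj p = 0 ∨ proj p = q := by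
  rw [lift_twoZeroField, smul_eq_zero, mul_eq_zero, hump_eq_zero_iff, hump_eq_zero_iff, sub_eq_zero]
  simp

theorem ContDiff.uncurry_fderiv {E F G : Type*} [NormedAddCommGroup E] [NormedSpace ℝ E]
    [NormedAddCommGroup F] [NormedSpace ℝ F] [NormedAddCommGroup G] [NormedSpace ℝ G]
    {f : E → F → G} {m n : WithTop ℕ∞} (hf : ContDiff ℝ m (Function.uncurry f)) (h : n + 1 ≤ m) :
    ContDiff ℝ n (Function.uncurry fun x => fderiv ℝ (f x)) :=
  ContDiff.fderiv (f := fun x : E × F => f x.1) (m := m)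
    (hf.comp (contDiff_fst.fst.prodMk contDiff_snd)) contDiff_snd h

/-- A family of vector fields depends continuously on a parameter in the `C²` topology if it is
jointly of class `C²` in the parameter and the point. -/
theorem C2VectorField.continuous_of_contDiff {E : Type*} [NormedAddCommGroup E] [NormedSpace ℝ E]
    {v : E → C2VectorField} (hv : ContDiff ℝ 2 (Function.uncurry fun q => (v q).lift)) :
    Continuous v := by
  have h1 : ContDiff ℝ 1 _ := hv.uncurry_fderiv (by norm_num)
  have h2 : ContDiff ℝ 0 _ := h1.uncurry_fderiv (by norm_num)
  refine continuous_induced_rng.2 (Continuous.prodMk ?_ (Continuous.prodMk ?_ ?_))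
  · exact ContinuousMap.continuous_of_continuous_uncurry _ hv.continuous
  · exact ContinuousMap.continuous_of_continuous_uncurry _ h1.continuous
  · exact ContinuousMap.continuous_of_continuous_uncurry _ h2.continuous

theorem continuous_twoZeroField_proj (α : ℝ) :
    Continuous fun q : ℝ × ℝ => twoZeroField α (proj q) :=
  C2VectorField.continuous_of_contDiff (contDiff_twoZeroField_lift α)

theorem continuous_twoZeroField_vertical (α : ℝ) :
    Continuous fun x : UnitAddCircle => twoZeroField α (0, x) := by
  refine continuous_coinduced_dom.2 ?_
  exact (continuous_twoZeroField_proj α).comp (continuous_const (y := (0 : ℝ)).prodMk continuous_id)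

/-! ### Sliding along the leaves of the linear flow -/

/-- The map of the torus that moves each point `z` along its leaf of the linear flow of slope `α`
by the time `a * hump z`. It fixes the origin, and is a homeomorphism for small `a`. -/
noncomputable def slide (α a : ℝ) (z : Torus) : Torus := flow α (a * hump z) z

theorem slide_zero (α a : ℝ) : slide α a 0 = 0 := by
  rw [slide, hump_eq_zero_iff.2 rfl, mul_zero, flow_zero]

@[fun_prop]
theorem continuous_slide (α a : ℝ) : Continuous (slide α a) :=
  (continuous_flow α).comp (by fun_prop : Continuous fun z : Torus => (a * hump z, z))

theorem slide_sub_slide (α a : ℝ) (z w : Torus) :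
    slide α a z - slide α a w = flow α (a * (hump z - hump w)) (z - w) := by
  have h : proj (a * (hump z - hump w), α * (a * (hump z - hump w)))
      = proj (a * hump z, α * (a * hump z)) - proj (a * hump w, α * (a * hump w)) := by
    rw [← proj_sub, Prod.mk_sub_mk, mul_sub, mul_sub]
  rw [slide, slide, flow, flow, flow, h]
  abel

/-- A slide increases squared distances, as measured by `hump`, by at most a constant factor. -/
theorem hump_slide_sub_le (α a : ℝ) (z w : Torus) :
    hump (slide α a z - slide α a w) ≤ (2 + 4 * π ^ 2 * (1 + α ^ 2) * a ^ 2) * hump (z - w) := by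
  rw [slide_sub_slide]
  refine (hump_flow_le _ _ _).trans ?_
  have h := mul_le_mul_of_nonneg_left (sq_hump_sub_le z w)
    (by positivity : 0 ≤ 2 * π ^ 2 * (1 + α ^ 2) * a ^ 2)
  linear_combination h

variable {α a : ℝ}

theorem slide_bijective (ha : |a| * (π * (1 + |α|)) ≤ 1 / 2) :
    Function.Bijective (slide α a) := by
  have hlip : ∀ (z : Torus) (u : ℝ), |a * (hump (flow α u z) - hump z)| ≤ |u| / 2 := fun z u => by
    rw [abs_mul]
    calc |a| * |hump (flow α u z) - hump z| ≤ |a| * (π * (1 + |α|) * |u|) :=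
          mul_le_mul_of_nonneg_left (abs_hump_flow_sub_le α u z) (abs_nonneg a)
      _ = |a| * (π * (1 + |α|)) * |u| := by ring
      _ ≤ 1 / 2 * |u| := mul_le_mul_of_nonneg_right ha (abs_nonneg u)
      _ = |u| / 2 := by ring
  constructor
  · intro z w h
    -- two points with the same image lie on one leaf, at a time difference `u` bounded by `|u| / 2`
    set u := -(a * hump w) + a * hump z with hu
    have hw : w = flow α u z := by
      rw [hu, flow_add]
      change w = flow α _ (slide α a z)
      rw [h, slide, ← flow_add, neg_add_cancel, flow_zero]
    have h1 := hlip z u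
    rw [← hw, show a * (hump w - hump z) = -u by rw [hu]; ring, abs_neg] at h1
    have h2 : u = 0 := abs_eq_zero.1 (le_antisymm (by linarith) (abs_nonneg u))
    rw [hw, h2, flow_zero]
  · intro z
    have hcont : Continuous fun u : ℝ => u + a * hump (flow α u z) :=
      continuous_id.add (continuous_const.mul (continuous_hump.comp
        ((continuous_flow α).comp (by fun_prop : Continuous fun u : ℝ => (u, z)))))
    have hb : ∀ u, |a * hump (flow α u z)| ≤ |a| * 2 := fun u => by
      rw [abs_mul, abs_of_nonneg (hump_nonneg _)]
      exact mul_le_mul_of_nonneg_left (hump_le_two _) (abs_nonneg a)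
    obtain ⟨u, -, hu⟩ := intermediate_value_Icc (a := -(|a| * 2)) (b := |a| * 2)
      (by linarith [abs_nonneg a]) hcont.continuousOn
      (show (0 : ℝ) ∈ _ from
        ⟨by linarith [(abs_le.1 (hb (-(|a| * 2)))).2], by linarith [(abs_le.1 (hb (|a| * 2))).1]⟩)
    refine ⟨flow α u z, ?_⟩
    dsimp only at hu
    rw [slide, ← flow_add, add_comm, hu, flow_zero]

theorem slide_homotopic :
    ContinuousMap.Homotopic ⟨slide α a, continuous_slide α a⟩ (ContinuousMap.id Torus) := by
  refine ContinuousMap.Homotopic.symm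
    ⟨⟨⟨fun p => slide α (p.1 * a) p.2, ?_⟩, fun z => ?_, fun z => ?_⟩⟩
  · unfold slide
    exact (continuous_flow α).comp (by fun_prop :
      Continuous fun p : unitInterval × Torus => ((p.1 : ℝ) * a * hump p.2, p.2))
  · simp [slide, flow_zero]
  · simp

/-- The pushforward of `twoZeroField α q` under a slide has the same orbits as the field of the same
type whose second zero is moved accordingly: the ratio of the two fields, which is the speed of the
time change, is bounded below by a positive constant (by `hump_slide_sub_le`, applied at both
zeros), so that the time change is onto `ℝ`. -/
theorem orbitallyEquivalent_twoZeroField_slide (ha : |a| * (π * (1 + |α|)) ≤ 1 / 2) (q : Torus) :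
    (twoZeroField α q).OrbitallyEquivalent (twoZeroField α (slide α a q)) := by
  have hbij := slide_bijective ha
  refine ⟨(continuous_slide α a).homeoOfEquivCompactToT2 (f := Equiv.ofBijective _ hbij),
    slide_homotopic, ?_⟩
  rintro γ ⟨c, hc, hγ⟩
  simp only [lift_twoZeroField] at hc
  change ∃ (τ : ℝ ≃o ℝ) (δ : ℝ → Torus), (twoZeroField α (slide α a q)).IsTrajectory δ ∧
    ∀ t, slide α a (γ t) = δ (τ t)
  set r : ℝ → ℝ := fun t => hump (proj (c t)) * hump (proj (c t) - q) with hr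
  set C : ℝ → ℝ × ℝ := fun t => c t + (a * hump (proj (c t))) • ((1, α) : ℝ × ℝ) with hC
  have hCproj : ∀ t, proj (C t) = slide α a (proj (c t)) := fun t => (flow_proj _ _ _).symm
  set k : ℝ → ℝ := fun t => 1 + a * humpDeriv α (c t) with hk
  have hCd : ∀ t, HasDerivAt C ((r t * k t) • ((1, α) : ℝ × ℝ)) t := fun t => by
    convert! (hc t).add (((HasDerivAt.hump_proj (hc t)).const_mul a).smul_const ((1, α) : ℝ × ℝ))
      using 1
    rw [← add_smul]
    congr 1
    simp only [hk, hr]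
    ring
  have hcc : Continuous c := continuous_iff_continuousAt.2 fun t => (hc t).continuousAt
  set s : ℝ → ℝ := fun t => hump (proj (C t)) * hump (proj (C t) - slide α a q) with hs
  have hzero : ∀ t, s t = 0 ↔ r t = 0 := fun t => by
    have h0 : slide α a (proj (c t)) = 0 ↔ proj (c t) = 0 := by
      rw [← hbij.1.eq_iff (a := proj (c t)) (b := 0), slide_zero]
    simp only [hs, hr, mul_eq_zero, hump_eq_zero_iff, sub_eq_zero, hCproj, h0, hbij.1.eq_iff]
  -- along a trajectory the speed satisfies a linear differential equation
  obtain ⟨l, hl, hrl⟩ : ∃ l : ℝ → ℝ, Continuous l ∧ ∀ t, HasDerivAt r (r t * l t) t := by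
    obtain ⟨q, rfl⟩ := proj_surjective q
    refine ⟨fun t => humpDeriv α (c t) * hump (proj (c t) - proj q) +
      hump (proj (c t)) * humpDeriv α (c t - q), by fun_prop, fun t => ?_⟩
    have h2 := HasDerivAt.hump_proj (c := fun t => c t - q) ((hc t).sub_const q)
    simp only [proj_sub] at h2
    convert! (HasDerivAt.hump_proj (hc t)).mul h2 using 1
    simp only [hr]
    ring
  by_cases h : ∃ t, r t = 0
  · obtain ⟨t₀, ht₀⟩ := h
    have hr0 := eq_zero_of_hasDerivAt_mul_self hl hrl ht₀
    refine ⟨OrderIso.refl ℝ, fun t => proj (C t), ⟨C, fun t => ?_, fun t => rfl⟩, fun t => ?_⟩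
    · convert! hCd t using 1
      rw [lift_twoZeroField, hr0 t, zero_mul]
      congr 1
      exact (hzero t).2 (hr0 t)
    · rw [hγ, ← hCproj]
      rfl
  · push Not at h
    have hsne : ∀ t, s t ≠ 0 := fun t => (hzero t).not.2 (h t)
    have hspos : ∀ t, 0 < s t := fun t =>
      (mul_nonneg (hump_nonneg _) (hump_nonneg _)).lt_of_ne' (hsne t)
    set K := 2 + 4 * π ^ 2 * (1 + α ^ 2) * a ^ 2 with hK
    have hK0 : 0 < K := by positivity
    have hsr : ∀ t, s t ≤ K ^ 2 * r t := fun t => by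
      have h1 := hump_slide_sub_le α a (proj (c t)) 0
      have h2 := hump_slide_sub_le α a (proj (c t)) q
      rw [slide_zero, sub_zero, sub_zero] at h1
      simp only [hs, hr, hCproj]
      refine (mul_le_mul h1 h2 (hump_nonneg _) (mul_nonneg hK0.le (hump_nonneg _))).trans_eq ?_
      ring
    have hkhalf : ∀ t, 1 / 2 ≤ k t := fun t => by
      have h1 : |a * humpDeriv α (c t)| ≤ 1 / 2 := by
        rw [abs_mul]
        exact (mul_le_mul_of_nonneg_left (abs_humpDeriv_le _ _) (abs_nonneg a)).trans ha
      have := (abs_le.1 h1).1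
      simp only [hk]
      linarith
    have hCc : Continuous C := continuous_iff_continuousAt.2 fun t => (hCd t).continuousAt
    obtain ⟨τ, -, hτ⟩ := exists_orderIso_hasDerivAt (ρ := fun t => r t * k t / s t)
      (Continuous.div (by simp only [hr, hk]; fun_prop) (by simp only [hs]; fun_prop) hsne)
      (m := (2 * K ^ 2)⁻¹) (by positivity) (fun t => by
        rw [le_div_iff₀ (hspos t), inv_mul_le_iff₀ (by positivity)]
        have hr0 : 0 ≤ r t := mul_nonneg (hump_nonneg _) (hump_nonneg _)
        have h1 := mul_le_mul_of_nonneg_left (hkhalf t) (mul_nonneg (sq_nonneg K) hr0)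
        linarith [hsr t])
    refine ⟨τ, fun x => proj (C (τ.symm x)), ⟨fun x => C (τ.symm x), fun x => ?_, fun x => rfl⟩,
      fun t => ?_⟩
    · convert! (hCd (τ.symm x)).scomp x (hτ x) using 1
      rw [lift_twoZeroField, smul_smul]
      congr 1
      change s (τ.symm x) = _
      have h1 := h (τ.symm x)
      have h2 : k (τ.symm x) ≠ 0 := (one_half_pos.trans_le (hkhalf _)).ne'
      have h3 := hsne (τ.symm x)
      field_simp
    · simp only [hγ, ← hCproj, τ.symm_apply_apply]

/-- A small displacement of a nonzero point `q` along its leaf does not change the class of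
`twoZeroField α q`. -/
theorem eventually_orbitallyEquivalent_flow (α : ℝ) {q : Torus} (hq : q ≠ 0) :
    ∀ᶠ t in 𝓝 (0 : ℝ),
      (twoZeroField α q).OrbitallyEquivalent (twoZeroField α (flow α t q)) := by
  have hpos := hump_pos hq
  have h : ContinuousAt (fun t : ℝ => |t / hump q| * (π * (1 + |α|))) 0 := by fun_prop
  filter_upwards [h.eventually_le_const (u := 1 / 2) (by norm_num)] with t ht
  have := orbitallyEquivalent_twoZeroField_slide ht q
  rwa [slide, div_mul_cancel₀ _ hpos.ne'] at this

theorem sub_mem_zmultiples_of_flow_eq {x y : UnitAddCircle} {t : ℝ}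
    (h : flow α t (0, x) = (0, y)) : y - x ∈ AddSubgroup.zmultiples (α : UnitAddCircle) := by
  rw [flow, proj, Prod.mk_add_mk, zero_add, Prod.mk_inj, UnitAddCircle.coe_eq_zero_iff] at h
  obtain ⟨⟨n, rfl⟩, rfl⟩ := h
  refine AddSubgroup.mem_zmultiples_iff.2 ⟨n, ?_⟩
  rw [← AddCircle.coe_zsmul, zsmul_eq_mul, mul_comm, add_sub_cancel_left]

/-- If the leaf through `(0, x)` avoids the origin, then moving the zero `(0, x)` along it once
around the torus does not change an invariant of orbital equivalence. -/
theorem invariant_twoZeroField_add {Y : Type*} {g : C2VectorField → Y}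
    (hg : ∀ v w : C2VectorField, v.OrbitallyEquivalent w → g v = g w)
    {x : UnitAddCircle} (hx : x ∉ AddSubgroup.zmultiples (α : UnitAddCircle)) :
    g (twoZeroField α (0, (α : UnitAddCircle) + x)) = g (twoZeroField α (0, x)) := by
  have hne : ∀ t : ℝ, flow α t (0, x) ≠ 0 := fun t ht => by
    have h := sub_mem_zmultiples_of_flow_eq (y := 0) ht
    rw [zero_sub, neg_mem_iff] at h
    exact hx h
  have hloc : IsLocallyConstant fun t : ℝ => g (twoZeroField α (flow α t (0, x))) := by
    refine (IsLocallyConstant.iff_eventually_eq _).2 fun t => ?_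
    have h := eventually_orbitallyEquivalent_flow α (hne t)
    have ht : Tendsto (fun s : ℝ => s - t) (𝓝 t) (𝓝 0) := by
      simpa using (by fun_prop : Continuous fun s : ℝ => s - t).tendsto t
    filter_upwards [ht.eventually h] with s hs
    rw [← flow_add, sub_add_cancel] at hs
    exact (hg _ _ hs).symm
  have h := hloc.apply_eq_of_preconnectedSpace 1 0
  rw [flow_zero] at h
  have h1 : ((1 : ℝ) : UnitAddCircle) = 0 := AddCircle.coe_period 1
  have h2 : flow α 1 (0, x) = (0, (α : UnitAddCircle) + x) := by
    simp [flow, proj, h1, add_comm]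
  rwa [h2] at h

/-! ### Lifting maps homotopic to the identity -/

/-- A null-homotopic circle-valued function lifts to a real-valued one. -/
theorem exists_lift_of_homotopy {X : Type*} [TopologicalSpace X]
    (G : C(unitInterval × X, UnitAddCircle)) (hG : ∀ z, G (0, z) = 0) :
    ∃ d : C(X, ℝ), ∀ z, G (1, z) = (d z : UnitAddCircle) := by
  have cov := AddCircle.isCoveringMap_coe (1 : ℝ)
  have h0 : ∀ z, G (0, z) = (((0 : C(X, ℝ)) z : ℝ) : UnitAddCircle) := fun z => by simp [hG]
  refine ⟨(cov.liftHomotopy G 0 h0).comp ⟨fun z => (1, z), by fun_prop⟩, fun z => ?_⟩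
  exact (congr_fun (cov.liftHomotopy_lifts G 0 h0) (1, z)).symm

/-- A self-map of the torus that is homotopic to the identity differs from it by a displacement that
lifts to a continuous `ℝ²`-valued function. -/
theorem exists_displacement {H : C(Torus, Torus)} (h : H.Homotopic (ContinuousMap.id Torus)) :
    ∃ d : C(Torus, ℝ × ℝ), ∀ z, H z = z + proj (d z) := by
  obtain ⟨F⟩ := h.symm
  have hF : Continuous fun p : unitInterval × Torus => F p - p.2 :=
    F.continuous.sub continuous_snd
  obtain ⟨d₁, h₁⟩ := exists_lift_of_homotopy
    ⟨fun p : unitInterval × Torus => (F p - p.2).1, hF.fst⟩ (fun z => by simp)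
  obtain ⟨d₂, h₂⟩ := exists_lift_of_homotopy
    ⟨fun p : unitInterval × Torus => (F p - p.2).2, hF.snd⟩ (fun z => by simp)
  refine ⟨d₁.prodMk d₂, fun z => ?_⟩
  rw [← sub_eq_iff_eq_add']
  refine Prod.ext ?_ ?_
  · simpa [proj] using h₁ z
  · simpa [proj] using h₂ z

theorem UnitAddCircle.eq_of_forall_coe_eq_zero {κ : ℝ → ℝ} (hκ : Continuous κ)
    (h : ∀ t, (κ t : UnitAddCircle) = 0) (s t : ℝ) : κ s = κ t :=
  congr_fun ((AddCircle.isCoveringMap_coe (1 : ℝ)).eq_of_comp_eq hκ continuous_const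
    (funext fun r => (h r).trans (h t).symm) t rfl) s

theorem Torus.eq_of_forall_proj_eq_zero {κ : ℝ → ℝ × ℝ} (hκ : Continuous κ)
    (h : ∀ t, proj (κ t) = 0) (s t : ℝ) : κ s = κ t :=
  Prod.ext
    (UnitAddCircle.eq_of_forall_coe_eq_zero hκ.fst (fun t => congr_arg Prod.fst (h t)) s t)
    (UnitAddCircle.eq_of_forall_coe_eq_zero hκ.snd (fun t => congr_arg Prod.snd (h t)) s t)

/-- The constant trajectories are the zeros of the vector field. -/
theorem C2VectorField.isTrajectory_const_iff {v : C2VectorField} {z : Torus} :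
    v.IsTrajectory (fun _ => z) ↔ v.toFun z = 0 := by
  constructor
  · rintro ⟨c, hc, hz⟩
    replace hz : ∀ t, z = proj (c t) := hz
    have hcc : Continuous c := continuous_iff_continuousAt.2 fun t => (hc t).continuousAt
    have hconst : ∀ t, c t = c 0 := fun t => by
      have := Torus.eq_of_forall_proj_eq_zero (κ := fun t => c t - c 0) (by fun_prop)
        (fun t => by rw [proj_sub, ← hz t, ← hz 0, sub_self]) t 0
      simpa [sub_eq_zero] using this
    have hd : HasDerivAt c 0 0 := by
      rw [funext hconst]
      exact hasDerivAt_const _ _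
    rw [hz 0]
    exact (hc 0).unique hd
  · intro h
    obtain ⟨p, rfl⟩ := proj_surjective z
    refine ⟨fun _ => p, fun t => ?_, fun t => rfl⟩
    have : v.lift p = 0 := h
    rw [this]
    exact hasDerivAt_const _ _

/-! ### Rigidity -/


/-- For irrational `α` the leaves of the linear flow of slope `α` are dense. -/
theorem eq_of_forall_flow_eq (hα : Irrational α) {D : Torus → ℝ} (hD : Continuous D) {z : Torus}
    {b : ℝ} (h : ∀ t, D (flow α t z) = b) (w : Torus) : D w = b := by
  obtain ⟨t₀, ht₀⟩ : ∃ t₀ : ℝ, (t₀ : UnitAddCircle) = w.1 - z.1 :=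
    QuotientAddGroup.mk_surjective (w.1 - z.1)
  have hdense : DenseRange ((· • (α : UnitAddCircle)) : ℤ → UnitAddCircle) :=
    AddCircle.denseRange_zsmul_coe_iff.2 (by simpa using hα)
  have heq := DenseRange.equalizer
    (g := fun y => D (w.1, z.2 + ((α * t₀ : ℝ) : UnitAddCircle) + y)) (h := fun _ => b)
    hdense (by fun_prop) continuous_const (funext fun n => by
      change D _ = b
      rw [← h ((t₀ : ℝ) + (n : ℝ))]
      refine congr_arg D (Prod.ext ?_ ?_)
      · simp [flow, proj, ht₀]
      · simp [flow, proj, mul_add, add_assoc, ← AddCircle.coe_zsmul, mul_comm])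
  have := congr_fun heq (w.2 - (z.2 + ((α * t₀ : ℝ) : UnitAddCircle)))
  simpa only [add_sub_cancel] using this

/-- A leaf that contains no zero of `twoZeroField α (0, x)` is a single orbit of this field. -/
theorem exists_isTrajectory_flow {x y : UnitAddCircle}
    (hy : y ∉ AddSubgroup.zmultiples (α : UnitAddCircle))
    (hxy : x - y ∉ AddSubgroup.zmultiples (α : UnitAddCircle)) :
    ∃ u : ℝ ≃o ℝ, (twoZeroField α (0, x)).IsTrajectory fun t => flow α (u t) (0, y) := by
  have h0 : ∀ t : ℝ, flow α t (0, y) ≠ 0 := fun t ht => by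
    have h := sub_mem_zmultiples_of_flow_eq (y := 0) ht
    rw [zero_sub, neg_mem_iff] at h
    exact hy h
  have hx : ∀ t : ℝ, flow α t (0, y) ≠ (0, x) := fun t ht => hxy (sub_mem_zmultiples_of_flow_eq ht)
  set F : ℝ → ℝ := fun u => hump (flow α u (0, y)) * hump (flow α u (0, y) - (0, x)) with hF
  have hflow : Continuous fun u : ℝ => flow α u (0, y) :=
    (continuous_flow α).comp (by fun_prop : Continuous fun u : ℝ => (u, ((0, y) : Torus)))
  have hFc : Continuous F := by fun_prop
  have hFpos : ∀ u, 0 < F u := fun u =>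
    mul_pos (hump_pos (h0 u)) (hump_pos (sub_ne_zero.2 (hx u)))
  have hF4 : ∀ u, F u ≤ 2 * 2 := fun u =>
    mul_le_mul (hump_le_two _) (hump_le_two _) (hump_nonneg _) zero_le_two
  obtain ⟨τ, -, hτ⟩ := exists_orderIso_hasDerivAt (hFc.inv₀ fun u => (hFpos u).ne')
    (m := (2 * 2)⁻¹) (by norm_num) (fun u => inv_anti₀ (hFpos u) (hF4 u))
  replace hτ : ∀ s, HasDerivAt τ.symm (F (τ.symm s)) s := fun s => by simpa using hτ s
  obtain ⟨p, hp⟩ := proj_surjective (0, y)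
  refine ⟨τ.symm, fun t => p + τ.symm t • ((1, α) : ℝ × ℝ), fun t => ?_, fun t => ?_⟩
  · rw [lift_twoZeroField, ← flow_proj, hp]
    exact ((hτ t).smul_const _).const_add p
  · simp only [← hp, flow_proj]

/-- The component of the displacement transverse to the leaves is constant along each orbit. -/
theorem transverse_displacement_eq {q q' : Torus} {H : Torus → Torus} {d : C(Torus, ℝ × ℝ)}
    (hd : ∀ z, H z = z + proj (d z)) {γ δ : ℝ → Torus} {τ : ℝ ≃o ℝ}
    (hγ : (twoZeroField α q).IsTrajectory γ) (hδ : (twoZeroField α q').IsTrajectory δ)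
    (h : ∀ t, H (γ t) = δ (τ t)) (t : ℝ) :
    (d (γ t)).2 - α * (d (γ t)).1 = (d (γ 0)).2 - α * (d (γ 0)).1 := by
  -- integral curves of the lifted fields stay on lines of slope `α`
  have hline : ∀ {q : Torus} {c : ℝ → ℝ × ℝ},
      (∀ t, HasDerivAt c ((twoZeroField α q).lift (c t)) t) →
      ∀ s t, (c s).2 - α * (c s).1 = (c t).2 - α * (c t).1 := fun {q c} hc => by
    have hD : ∀ t, HasDerivAt (fun t => (c t).2 - α * (c t).1) 0 t := fun t => by
      convert! ((ContinuousLinearMap.snd ℝ ℝ ℝ -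
        α • ContinuousLinearMap.fst ℝ ℝ ℝ).hasFDerivAt.comp_hasDerivAt t (hc t)) using 1
      simp [lift_twoZeroField, mul_comm]
    exact is_const_of_deriv_eq_zero (fun t => (hD t).differentiableAt) fun t => (hD t).deriv
  obtain ⟨c, hc, hcγ⟩ := hγ
  obtain ⟨c', hc', hcδ⟩ := hδ
  have hcc : Continuous c := continuous_iff_continuousAt.2 fun t => (hc t).continuousAt
  have hcc' : Continuous c' := continuous_iff_continuousAt.2 fun t => (hc' t).continuousAt
  have hγc : Continuous γ := by
    rw [funext hcγ]
    fun_prop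
  have hτ : Continuous τ := τ.continuous
  have hκ := Torus.eq_of_forall_proj_eq_zero (κ := fun t => c t + d (γ t) - c' (τ t))
    (by fun_prop) (fun t => by rw [proj_sub, proj_add, ← hcγ, ← hcδ, ← hd, h, sub_self]) t 0
  have h1 := congr_arg Prod.fst hκ
  have h2 := congr_arg Prod.snd hκ
  simp only [Prod.fst_sub, Prod.fst_add, Prod.snd_sub, Prod.snd_add] at h1 h2
  linear_combination h2 - α * h1 - hline hc t 0 + hline hc' (τ t) (τ 0)

instance : Nontrivial UnitAddCircle :=
  ⟨((1 / 2 : ℝ) : UnitAddCircle), 0, fun h => by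
    have h1 : sinSq ((1 / 2 : ℝ) : UnitAddCircle) = 0 := sinSq_eq_zero_iff.2 h
    rw [sinSq_coe, mul_one_div, sin_pi_div_two] at h1
    norm_num at h1⟩

theorem exists_notMem_of_countable {s : Set UnitAddCircle} (hs : s.Countable) : ∃ y, y ∉ s := by
  by_contra! h
  have h0 := hs.measure_zero MeasureTheory.volume
  rw [eq_univ_of_forall h] at h0
  simp at h0

/-- The position of the second zero, up to sign and multiples of `α`, is an invariant of orbital
equivalence. -/
theorem sub_mem_or_add_mem_of_orbitallyEquivalent (hα : Irrational α) {x x' : UnitAddCircle}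
    (hx : x ≠ 0)
    (h : (twoZeroField α (0, x)).OrbitallyEquivalent (twoZeroField α (0, x'))) :
    x' - x ∈ AddSubgroup.zmultiples (α : UnitAddCircle) ∨
      x' + x ∈ AddSubgroup.zmultiples (α : UnitAddCircle) := by
  obtain ⟨H, hH, htraj⟩ := h
  obtain ⟨d, hd⟩ := exists_displacement hH
  replace hd : ∀ z, H z = z + proj (d z) := hd
  set A := AddSubgroup.zmultiples (α : UnitAddCircle) with hA
  obtain ⟨b, hb⟩ : ∃ b, ∀ z, (d z).2 - α * (d z).1 = b := by
    have hAc : (A : Set UnitAddCircle).Countable := by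
      rw [hA, AddSubgroup.coe_zmultiples]
      exact countable_range _
    obtain ⟨y, hy⟩ := exists_notMem_of_countable
      (hAc.union (hAc.preimage_of_injOn (sub_right_injective (b := x)).injOn))
    simp only [mem_union, mem_preimage, not_or, SetLike.mem_coe] at hy
    obtain ⟨u, hu⟩ := exists_isTrajectory_flow hy.1 hy.2
    obtain ⟨τ, δ, hδ, hHδ⟩ := htraj _ hu
    refine ⟨(d (flow α (u 0) (0, y))).2 - α * (d (flow α (u 0) (0, y))).1,
      eq_of_forall_flow_eq hα (D := fun z => (d z).2 - α * (d z).1) (z := (0, y))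
      (by fun_prop) fun t => ?_⟩
    have := transverse_displacement_eq hd hu hδ hHδ (u.symm t)
    rwa [u.apply_symm_apply] at this
  have hzero : ∀ z, (twoZeroField α (0, x)).toFun z = 0 → H z = 0 ∨ H z = (0, x') := fun z hz => by
    obtain ⟨τ, δ, hδ, hHδ⟩ := htraj _ (C2VectorField.isTrajectory_const_iff.2 hz)
    have hδc : δ = fun _ => H z := funext fun t => by rw [hHδ (τ.symm t), τ.apply_symm_apply]
    rw [hδc, C2VectorField.isTrajectory_const_iff] at hδ
    obtain ⟨p, hp⟩ := proj_surjective (H z)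
    rw [← hp] at hδ ⊢
    exact lift_twoZeroField_eq_zero_iff.1 hδ
  have h0 := hzero 0 (lift_twoZeroField_eq_zero_iff (p := 0).2 (Or.inl rfl))
  have h1 := hzero (0, x) (by
    obtain ⟨p, hp⟩ := proj_surjective (0, x)
    have h := (lift_twoZeroField_eq_zero_iff (α := α) (q := (0, x)) (p := p)).2 (Or.inr hp)
    rwa [C2VectorField.lift, hp] at h)
  have hne : H 0 ≠ H (0, x) := fun h => hx (congr_arg Prod.snd (H.injective h)).symm
  -- a zero on the circle `{0} × (ℝ/ℤ)` that is sent to this circle is moved by `b` modulo `A`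
  have hmove : ∀ s s' : UnitAddCircle, H (0, s) = (0, s') → s' - s - (b : UnitAddCircle) ∈ A := by
    intro s s' hs
    rw [hd, proj, Prod.mk_add_mk, zero_add, Prod.mk_inj, UnitAddCircle.coe_eq_zero_iff] at hs
    obtain ⟨⟨n, hn⟩, rfl⟩ := hs
    refine AddSubgroup.mem_zmultiples_iff.2 ⟨n, ?_⟩
    rw [← hb (0, s), hn, ← AddCircle.coe_zsmul, add_sub_cancel_left, ← AddCircle.coe_sub,
      sub_sub_cancel, zsmul_eq_mul, mul_comm]
  rcases h0 with h0 | h0 <;> rcases h1 with h1 | h1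
  · exact absurd (h0.trans h1.symm) hne
  · left
    convert sub_mem (hmove _ _ h1) (hmove 0 0 h0) using 1
    abel
  · right
    convert sub_mem (hmove 0 _ h0) (hmove _ 0 h1) using 1
    abel
  · exact absurd (h0.trans h1.symm) hne

/-! ### Absence of a complete Borel invariant -/

theorem theorem1 {Y : Type*} [TopologicalSpace Y] [PolishSpace Y] [MeasurableSpace Y]
    [BorelSpace Y] :
    ¬ ∃ g : C2VectorField → Y, Measurable g ∧
      ∀ v w : C2VectorField, C2VectorField.OrbitallyEquivalent v w ↔ g v = g w := by
  rintro ⟨g, hgm, hg⟩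
  set α : ℝ := √2
  have hα : Irrational α := irrational_sqrt_two
  set A := AddSubgroup.zmultiples (α : UnitAddCircle) with hA
  have hAc : (A : Set UnitAddCircle).Countable := by
    rw [hA, AddSubgroup.coe_zmultiples]
    exact countable_range _
  have : Nonempty Y := ⟨g (twoZeroField α 0)⟩
  set G : UnitAddCircle → Y := fun x => g (twoZeroField α (0, x))
  have hGm : Measurable G := hgm.comp (continuous_twoZeroField_vertical α).measurable
  have herg : Ergodic ((α : UnitAddCircle) + ·) :=
    AddCircle.ergodic_add_left.2 (AddCircle.denseRange_zsmul_iff.1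
      (AddCircle.denseRange_zsmul_coe_iff.2 (by simpa using hα)))
  -- by ergodicity of the rotation, the invariant is almost everywhere equal to some `y`
  obtain ⟨y, hy⟩ := herg.ae_eq_const_of_ae_eq_comp₀ hGm.nullMeasurable (by
    filter_upwards [hAc.ae_notMem MeasureTheory.volume] with x hx
    exact invariant_twoZeroField_add (fun v w => (hg v w).1) hx)
  obtain ⟨x, hxy, hx⟩ :=
    (hy.and ((countable_singleton (0 : UnitAddCircle)).ae_notMem MeasureTheory.volume)).exists
  have hcount : ((· - x) ⁻¹' (A : Set UnitAddCircle) ∪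
      (· + x) ⁻¹' (A : Set UnitAddCircle)).Countable :=
    (hAc.preimage_of_injOn (sub_left_injective (b := x)).injOn).union
      (hAc.preimage_of_injOn (add_left_injective x).injOn)
  obtain ⟨x', hxy', hx'⟩ := (hy.and (hcount.ae_notMem MeasureTheory.volume)).exists
  exact hx' (sub_mem_or_add_mem_of_orbitallyEquivalent hα hx
    ((hg _ _).2 (hxy.trans hxy'.symm)))
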